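/- **Setting.** Fix $K$ arms, known $\sigma,\sigma'>0$, radii $L_1,\dots,L_K$, and offline sample sizes $N'_k=N'_k(T)\in\{0,1,2,\dots\}\cup\{+\infty\}$, which may depend on the horizon $T$. An instance is a pair $(\nu,\nu')$ of target laws $\nu_k=\mathcal N(\mu_k,\sigma^2)$ and source laws $\nu'_k=\mathcal N(\mu'_k,\sigma'^2)$ with $|\mu_k-\mu'_k|\le L_k$ for all $k$. For a horizon $T$, the learner first observes, for each arm $k$, $N'_k(T)$ independent samples of $\nu'_k$ (an infinite sequence if $N'_k(T)=+\infty$), independently over the arms. In each round $t=1,\dots,T$ it chooses an arm $a_t$, possibly at random, depending on the offline data and the past arms and rewards, and then receives a reward drawn from $\nu_{a_t}$. An algorithm consists of one such strategy for each horizon $T$. Let $N_k(T)$ be the number of $t\le T$ with $a_t=k$. An arm is suboptimal if its target mean is smaller than the largest target mean. The algorithm is consistent if, on every instance and for every suboptimal arm $k$ of that instance, $\mathbb E[N_k(T)]=o(T^\alpha)$ as $T\to\infty$ for all $\alpha>0$. Write $(x)_+=\max\{x,0\}$ and $\infty\cdot 0=0$. **Corollary (Gaussian lower bound).** Let the algorithm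 be consistent, let an instance be given whose arm $1$ has the largest target mean, and let $k$ be a suboptimal arm. In the boundary case $\mu_1=\mu'_k+L_k$ assume moreover that $N'_k(T)=O(\ln T)$. Then $$\liminf_{T\to\infty}\left(\frac{\mathbb E[N_k(T)]}{\ln T}\,\frac{(\mu_1-\mu_k)^2}{2\sigma^2}+\frac{N'_k(T)}{\ln T}\,\frac{(\mu_1-\mu'_k-L_k)_+^2}{2\sigma'^2}\right)\ge 1,$$ and, equivalently, $$\mathbb E[N_k(T)]\ \ge\ \frac{2\sigma^2}{(\mu_1-\mu_k)^2}\left(\ln T-N'_k(T)\,\frac{(\mu_1-\mu'_k-L_k)_+^2}{2\sigma'^2}\right)_+ + o(\ln T).$$ -/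

import Mathlib

open MeasureTheory ProbabilityTheory Filter Asymptotics
open scoped ENNReal NNReal

namespace TransferBandit

noncomputable section

/-- The data seen before the first round: for each arm `k`, a list of `n k` real samples,
where `n k = ⊤` means an infinite sequence of samples. -/
abbrev OfflineData {K : ℕ} (n : Fin K → ℕ∞) : Type :=
  (k : Fin K) → {i : ℕ // (i : ℕ∞) < n k} → ℝ

/-- The law of the offline data: all samples are independent, those of arm `k` have law `ν' k`. -/
def offlineLaw {K : ℕ} (n : Fin K → ℕ∞) (ν' : Fin K → ProbabilityMeasure ℝ) :
    Measure (OfflineData n) :=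
  Measure.pi fun k => Measure.infinitePi
    fun _ : {i : ℕ // (i : ℕ∞) < n k} => (ν' k : Measure ℝ)

/-- The arms pulled and the rewards observed during the first `t` rounds. -/
abbrev History (K t : ℕ) : Type := Fin t → Fin K × ℝ

/-- A (possibly randomized) sequential strategy: after `t` rounds, the law of the next arm is a
measurable function of the offline data and of the past arms and rewards. -/
structure Policy {K : ℕ} (n : Fin K → ℕ∞) where
  choice : (t : ℕ) → Kernel (OfflineData n × History K t) (Fin K)
  isMarkov : ∀ t, IsMarkovKernel (choice t)

/-- The reward kernel of a bandit: pulling arm `a` gives a reward of law `ν a`. -/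
def rewardKernel {K : ℕ} (ν : Fin K → ProbabilityMeasure ℝ) : Kernel (Fin K) ℝ where
  toFun a := (ν a : Measure ℝ)
  measurable' := measurable_of_countable _

/-- Appending one round (arm and reward) to the interaction so far. -/
def appendRound {K : ℕ} (n : Fin K → ℕ∞) (t : ℕ)
    (p : ((OfflineData n × History K t) × Fin K) × ℝ) : OfflineData n × History K (t + 1) :=
  (p.1.1.1, Fin.snoc (α := fun _ => Fin K × ℝ) p.1.1.2 (p.1.2, p.2))

/-- The canonical law of the offline data and of the first `t` rounds, for target arms `ν`,
source arms `ν'` and strategy `π`: first the offline data are drawn, then in each round the arm is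
drawn from the strategy and, given the arm, the reward is drawn from the law of that arm. -/
def law {K : ℕ} {n : Fin K → ℕ∞} (π : Policy n) (ν ν' : Fin K → ProbabilityMeasure ℝ) :
    (t : ℕ) → Measure (OfflineData n × History K t)
  | 0 => (offlineLaw n ν').map fun x => (x, Fin.elim0)
  | t + 1 => ((law π ν ν' t ⊗ₘ π.choice t) ⊗ₘ
      (rewardKernel ν).comap Prod.snd measurable_snd).map (appendRound n t)

/-- `N_k(T)`: the number of pulls of arm `k` in a history of length `T`. -/
def pulls {K T : ℕ} (k : Fin K) (h : History K T) : ℕ :=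
  (Finset.univ.filter fun t => (h t).1 = k).card

/-- `E[N_k(T)]` under target arms `ν`, source arms `ν'` and strategy `π`. -/
def expectedPulls {K : ℕ} {n : Fin K → ℕ∞} (π : Policy n)
    (ν ν' : Fin K → ProbabilityMeasure ℝ) (k : Fin K) (T : ℕ) : ℝ :=
  ∫ ω, (pulls k ω.2 : ℝ) ∂(law π ν ν' T)

/-- The mean of a law on the real line. -/
def mean (ν : ProbabilityMeasure ℝ) : ℝ := ∫ x, x ∂(ν : Measure ℝ)

/-- Consistency with respect to the families `D`, `D'` of target and source laws, the distances
`d k`, the radii `L k` and the offline sample sizes `N' T k` (which may depend on the horizon `T`;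
so an algorithm is given by one strategy for each horizon): on every admissible instance, every
suboptimal arm `k` satisfies `E[N_k(T)] = o(T ^ α)` for all `α > 0`. -/
def IsConsistent {K : ℕ} (D D' : Set (ProbabilityMeasure ℝ))
    (d : Fin K → ProbabilityMeasure ℝ → ProbabilityMeasure ℝ → ℝ) (L : Fin K → ℝ)
    (N' : ℕ → Fin K → ℕ∞) (π : (T : ℕ) → Policy (N' T)) : Prop :=
  ∀ ν ν' : Fin K → ProbabilityMeasure ℝ,
    (∀ i, ν i ∈ D) → (∀ i, ν' i ∈ D') → (∀ i, d i (ν i) (ν' i) ≤ L i) →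
    ∀ k : Fin K, (∃ j, mean (ν k) < mean (ν j)) →
    ∀ α : ℝ, 0 < α →
      (fun T : ℕ => expectedPulls (π T) ν ν' k T) =o[atTop] fun T : ℕ => (T : ℝ) ^ α

/-- The normal law with mean `m` and standard deviation `s`. -/
def normal (s : ℝ≥0) (m : ℝ) : ProbabilityMeasure ℝ := ⟨gaussianReal m (s ^ 2), inferInstance⟩

/-- The family of all normal laws with standard deviation `s`. -/
def normalFamily (s : ℝ≥0) : Set (ProbabilityMeasure ℝ) := Set.range (normal s)

/-- The mean-based distance. -/
def meanDist (ν ν' : ProbabilityMeasure ℝ) : ℝ := |mean ν - mean ν'|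

/-- The offline cost `n (q - m' - l)₊² / (2 s'²)`, where `n` may be infinite (with `∞ * 0 = 0`). -/
def offlineCost (s' : ℝ≥0) (n : ℕ∞) (q m' l : ℝ) : ℝ≥0∞ :=
  (n : ℝ≥0∞) * ENNReal.ofReal ((max (q - m' - l) 0) ^ 2 / (2 * (s' : ℝ) ^ 2))

end

end TransferBandit

/-! A change of measure: compare the instance with an alternative in which arm `k` has target mean
`q > μ best`, and its source mean is raised just enough to stay within `L k`. The two laws of data
and history differ in relative entropy by at most the expected pulls of `k` times `(q - μ k)² /
(2σ²)`, plus the offline cost at `q` (`EntropyBound.law`).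

Relative entropy enters only through `∫ log f ∂P ≤ log ∫ f ∂Q + c`, tested on `f = 1 + T - N_k`.
Under the alternative every arm but `k` is suboptimal, so consistency makes `∫ f ∂Q` smaller than
any power of `T`. Under the original instance `N_k` is `o(T)` in mean, and concavity makes `∫ log f
∂P` at least `(1 - o(1)) log T` (`EntropyBound.log_expectedPulls_le`). Hence `(1 - δ) log T` is
eventually below the total cost at `q` (`eventually_ofReal_log_le_of_lt`).

It remains to let `q` decrease to `μ best`; `eventually_offlineCost_le` controls the offline cost
uniformly in large `T`. -/

namespace TransferBandit

/-! ### Calculus of the entropy inequality. -/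

section EntropyBound

variable {α β : Type*} [MeasurableSpace α] [MeasurableSpace β]

/-- The Donsker–Varadhan form of the inequality `KL(P ‖ Q) ≤ c`, tested on bounded functions. -/
def EntropyBound (P Q : Measure α) (c : ℝ) : Prop :=
  ∀ f : α → ℝ, Measurable f → ∀ M : ℝ, (∀ x, 1 ≤ f x) → (∀ x, f x ≤ M) →
    ∫ x, Real.log (f x) ∂P ≤ Real.log (∫ x, f x ∂Q) + c

lemma integrable_of_bounds {P : Measure α} [IsFiniteMeasure P] {f : α → ℝ} (hf : Measurable f)
    {a b : ℝ} (ha : ∀ x, a ≤ f x) (hb : ∀ x, f x ≤ b) : Integrable f P :=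
  .of_mem_Icc a b hf.aemeasurable (.of_forall fun x => ⟨ha x, hb x⟩)

lemma one_le_integral_of_one_le {P : Measure α} [IsProbabilityMeasure P] {f : α → ℝ}
    (hf : Integrable f P) (h1 : ∀ x, 1 ≤ f x) : 1 ≤ ∫ x, f x ∂P := by
  simpa using integral_mono (integrable_const (1 : ℝ)) hf h1

lemma integral_le_of_forall_le {P : Measure α} [IsProbabilityMeasure P] {f : α → ℝ} {M : ℝ}
    (hf : Integrable f P) (hM : ∀ x, f x ≤ M) : ∫ x, f x ∂P ≤ M := by
  simpa using integral_mono hf (integrable_const M) hM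

lemma integrable_log_of_bounds {P : Measure α} [IsFiniteMeasure P] {f : α → ℝ}
    (hf : Measurable f) {M : ℝ} (h1 : ∀ x, 1 ≤ f x) (hM : ∀ x, f x ≤ M) :
    Integrable (fun x => Real.log (f x)) P :=
  integrable_of_bounds (Real.measurable_log.comp hf) (fun x => Real.log_nonneg (h1 x))
    fun x => Real.log_le_log (by linarith [h1 x]) (hM x)

/-- Integrate `log y ≤ y - 1` at `y = exp l * f / ∫ f ∂Q`, whose `P`-integral is `1`. The constant
is the relative entropy of `P` with respect to `Q`. -/
lemma EntropyBound.of_withDensity_exp {P Q : Measure α} [IsProbabilityMeasure P]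
    [IsProbabilityMeasure Q] {l : α → ℝ} (hl : Measurable l) (hli : Integrable l P)
    (hQ : Q = P.withDensity fun x => ENNReal.ofReal (Real.exp (l x))) :
    EntropyBound P Q (-∫ x, l x ∂P) := by
  intro f hf M h1 hM
  have hfQ : Integrable f Q := integrable_of_bounds hf h1 hM
  have hI : 1 ≤ ∫ x, f x ∂Q := one_le_integral_of_one_le hfQ h1
  set I := ∫ x, f x ∂Q with hIdef
  have hm : Measurable fun x => ENNReal.ofReal (Real.exp (l x)) := by fun_prop
  have hfin : ∀ᵐ x ∂P, ENNReal.ofReal (Real.exp (l x)) < ∞ := .of_forall fun x => by simp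
  have hint : ∫ x, Real.exp (l x) * f x ∂P = I := by
    rw [hIdef, hQ, integral_withDensity_eq_integral_toReal_smul hm hfin]
    simp [ENNReal.toReal_ofReal, Real.exp_nonneg]
  have hintg : Integrable (fun x => Real.exp (l x) * f x) P := by
    rw [hQ, integrable_withDensity_iff_integrable_smul' hm hfin] at hfQ
    simpa [ENNReal.toReal_ofReal, Real.exp_nonneg] using hfQ
  have hlog := integrable_log_of_bounds (P := P) hf h1 hM
  have key : ∀ x, Real.log (f x) + l x
      ≤ (Real.exp (l x) * f x) / I + (Real.log I - 1) := by
    intro x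
    have hx : 0 < f x := by linarith [h1 x]
    have h := Real.log_le_sub_one_of_pos (x := Real.exp (l x) * f x / I) (by positivity)
    rw [Real.log_div (by positivity) (by positivity), Real.log_mul (by positivity) hx.ne',
      Real.log_exp] at h
    linarith
  have := integral_mono (hlog.add hli) ((hintg.div_const I).add (integrable_const _)) key
  rw [integral_add' hlog hli, integral_add' (hintg.div_const I) (integrable_const _),
    integral_div, hint, div_self (by positivity)] at this
  simp at this
  linarith

lemma EntropyBound.refl (P : Measure α) [IsProbabilityMeasure P] : EntropyBound P P 0 := by
  simpa using EntropyBound.of_withDensity_exp (P := P) (Q := P) (l := 0) measurable_zero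
    (integrable_zero _ _ _) (by simp)

lemma EntropyBound.map {P Q : Measure α} {c : ℝ} (h : EntropyBound P Q c) {φ : α → β}
    (hφ : Measurable φ) : EntropyBound (P.map φ) (Q.map φ) c := by
  intro f hf M h1 hM
  rw [integral_map hφ.aemeasurable hf.aestronglyMeasurable,
    integral_map hφ.aemeasurable (f := fun x => Real.log (f x))
      (Real.measurable_log.comp hf).aestronglyMeasurable]
  exact h _ (hf.comp hφ) M (fun x => h1 _) fun x => hM _

/-- Chain rule: use the bound in each fibre, then the bound for `P`, `Q` on `a ↦ ∫ f (a, b) ∂η a`,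
which again lies between `1` and `M`. -/
lemma EntropyBound.compProd {P Q : Measure α} [IsProbabilityMeasure P] [IsProbabilityMeasure Q]
    {κ η : Kernel α β} [IsMarkovKernel κ] [IsMarkovKernel η] {c : ℝ} {d : α → ℝ}
    (h : EntropyBound P Q c) (hd : Integrable d P)
    (hκ : ∀ a, EntropyBound (κ a) (η a) (d a)) :
    EntropyBound (P ⊗ₘ κ) (Q ⊗ₘ η) (c + ∫ a, d a ∂P) := by
  intro f hf M h1 hM
  have hfa : ∀ a, Measurable fun b => f (a, b) := fun a => hf.comp measurable_prodMk_left
  have hfi : ∀ a, Integrable (fun b => f (a, b)) (η a) := fun a =>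
    integrable_of_bounds (hfa a) (fun b => h1 (a, b)) fun b => hM (a, b)
  have hg : Measurable fun a => ∫ b, f (a, b) ∂η a :=
    hf.stronglyMeasurable.integral_kernel_prod_right'.measurable
  have hg1 : ∀ a, 1 ≤ ∫ b, f (a, b) ∂η a := fun a =>
    one_le_integral_of_one_le (hfi a) fun b => h1 (a, b)
  have hgM : ∀ a, ∫ b, f (a, b) ∂η a ≤ M := fun a =>
    integral_le_of_forall_le (hfi a) fun b => hM (a, b)
  have hlog := integrable_log_of_bounds (P := P ⊗ₘ κ) hf h1 hM
  have hlogg := integrable_log_of_bounds (P := P) hg hg1 hgM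
  rw [Measure.integral_compProd hlog, Measure.integral_compProd (integrable_of_bounds hf h1 hM)]
  calc ∫ a, ∫ b, Real.log (f (a, b)) ∂κ a ∂P
      ≤ ∫ a, (Real.log (∫ b, f (a, b) ∂η a) + d a) ∂P := by
        refine integral_mono ?_ (hlogg.add hd) fun a =>
          hκ a _ (hfa a) M (fun b => h1 _) fun b => hM _
        exact ((Measure.integrable_compProd_iff hlog.aestronglyMeasurable).1 hlog).2.mono
          (Real.measurable_log.comp
            hf).stronglyMeasurable.integral_kernel_prod_right'.aestronglyMeasurable
          (.of_forall fun a => (norm_integral_le_integral_norm _).trans (le_abs_self _))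
    _ = ∫ a, Real.log (∫ b, f (a, b) ∂η a) ∂P + ∫ a, d a ∂P := integral_add hlogg hd
    _ ≤ _ := by linarith [h _ hg M hg1 hgM]

lemma EntropyBound.prod {P Q : Measure α} [IsProbabilityMeasure P] [IsProbabilityMeasure Q]
    {P' Q' : Measure β} [IsProbabilityMeasure P'] [IsProbabilityMeasure Q'] {c c' : ℝ}
    (h : EntropyBound P Q c) (h' : EntropyBound P' Q' c') :
    EntropyBound (P.prod P') (Q.prod Q') (c + c') := by
  simpa [Measure.compProd_const] using
    h.compProd (κ := Kernel.const α P') (η := Kernel.const α Q') (integrable_const c')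
      fun a => by simpa using h'

lemma EntropyBound.pi_fin {n : ℕ} {X : Fin n → Type*} [∀ i, MeasurableSpace (X i)]
    {P Q : (i : Fin n) → Measure (X i)} [∀ i, IsProbabilityMeasure (P i)]
    [∀ i, IsProbabilityMeasure (Q i)] {c : Fin n → ℝ}
    (h : ∀ i, EntropyBound (P i) (Q i) (c i)) :
    EntropyBound (Measure.pi P) (Measure.pi Q) (∑ i, c i) := by
  induction n with
  | zero =>
    have : P = Q := funext fun i => i.elim0
    subst this
    simpa using EntropyBound.refl (Measure.pi P)
  | succ n ih =>
    have hP := (measurePreserving_piFinSuccAbove P 0).symm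
    have hQ := (measurePreserving_piFinSuccAbove Q 0).symm
    rw [← hP.map_eq, ← hQ.map_eq, Fin.sum_univ_succ]
    exact ((h 0).prod (ih fun i => h _)).map (MeasurableEquiv.measurable _)

lemma EntropyBound.infinitePi_const {ι : Type*} [Finite ι] {P Q : Measure α}
    [IsProbabilityMeasure P] [IsProbabilityMeasure Q] {c : ℝ} (h : EntropyBound P Q c) :
    EntropyBound (Measure.infinitePi fun _ : ι => P) (Measure.infinitePi fun _ : ι => Q)
      (Nat.card ι * c) := by
  have e := (Finite.equivFin ι).symm
  rw [← Measure.infinitePi_map_piCongrLeft (fun _ : ι => P) e,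
    ← Measure.infinitePi_map_piCongrLeft (fun _ : ι => Q) e,
    Measure.infinitePi_eq_pi, Measure.infinitePi_eq_pi]
  refine EntropyBound.map ?_ (MeasurableEquiv.measurable _)
  simpa using EntropyBound.pi_fin fun _ : Fin (Nat.card ι) => h

lemma entropyBound_gaussianReal (m m' : ℝ) {v : ℝ≥0} (hv : v ≠ 0) :
    EntropyBound (gaussianReal m v) (gaussianReal m' v) ((m' - m) ^ 2 / (2 * v)) := by
  have hv' : (v : ℝ) ≠ 0 := by exact_mod_cast hv
  let l : ℝ → ℝ := fun x => (m' - m) / v * x + (m ^ 2 - m' ^ 2) / (2 * v)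
  have hid : Integrable (fun x : ℝ => x) (gaussianReal m v) :=
    (memLp_id_gaussianReal 1).integrable le_rfl
  have hl : Measurable l := by fun_prop
  have hli : Integrable l (gaussianReal m v) := (hid.const_mul _).add (integrable_const _)
  have h := EntropyBound.of_withDensity_exp (Q := gaussianReal m' v) hl hli ?_
  · convert h using 1
    simp only [l]
    rw [integral_add (hid.const_mul _) (integrable_const _), integral_const_mul,
      integral_id_gaussianReal]
    simp
    field_simp
    ring
  · rw [gaussianReal_of_var_ne_zero m hv, gaussianReal_of_var_ne_zero m' hv,
      ← withDensity_mul _ (measurable_gaussianPDF m v) (by fun_prop)]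
    congr 1
    ext x
    simp only [gaussianPDF, Pi.mul_apply]
    rw [← ENNReal.ofReal_mul (gaussianPDFReal_nonneg _ _ _)]
    congr 1
    simp only [gaussianPDFReal, l]
    rw [mul_assoc _ (Real.exp _), ← Real.exp_add]
    congr 2
    field_simp
    ring

end EntropyBound

end TransferBandit

namespace TransferBandit

/-! ### Entropy along the interaction, and its effect on pull counts. -/

section Law

variable {K : ℕ} {n : Fin K → ℕ∞}

instance (ν' : Fin K → ProbabilityMeasure ℝ) : IsProbabilityMeasure (offlineLaw n ν') := by
  unfold offlineLaw; infer_instance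

instance (π : Policy n) (t : ℕ) : IsMarkovKernel (π.choice t) := π.isMarkov t

instance (ν : Fin K → ProbabilityMeasure ℝ) : IsMarkovKernel (rewardKernel ν) :=
  ⟨fun a => inferInstanceAs (IsProbabilityMeasure (ν a : Measure ℝ))⟩

lemma measurable_appendRound (t : ℕ) : Measurable (appendRound n t) := by
  refine Measurable.prodMk (by fun_prop) (measurable_pi_iff.2 fun i => ?_)
  refine Fin.lastCases ?_ (fun j => ?_) i
  · simp only [Fin.snoc_last]; fun_prop
  · simp only [Fin.snoc_castSucc]; fun_prop

instance isProbabilityMeasure_law (π : Policy n) (ν ν' : Fin K → ProbabilityMeasure ℝ) (t : ℕ) :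
    IsProbabilityMeasure (law π ν ν' t) := by
  induction t with
  | zero =>
    exact Measure.isProbabilityMeasure_map
      (Measurable.prodMk measurable_id measurable_const).aemeasurable
  | succ t ih => exact Measure.isProbabilityMeasure_map (measurable_appendRound t).aemeasurable

lemma pulls_eq_sum {T : ℕ} (k : Fin K) (h : History K T) :
    pulls k h = ∑ t, if (h t).1 = k then 1 else 0 := by
  simp [pulls]

lemma measurable_pulls {T : ℕ} (k : Fin K) : Measurable (pulls k : History K T → ℕ) := by
  rw [funext (pulls_eq_sum k)]
  exact Finset.measurable_sum _ fun t _ =>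
    (measurable_of_countable fun a : Fin K => if a = k then 1 else 0).comp (by fun_prop)

lemma measurable_pulls_snd {T : ℕ} (k : Fin K) :
    Measurable fun ω : OfflineData n × History K T => (pulls k ω.2 : ℝ) :=
  measurable_from_nat.comp ((measurable_pulls k).comp measurable_snd)

lemma pulls_le {T : ℕ} (k : Fin K) (h : History K T) : pulls k h ≤ T :=
  (Finset.card_filter_le Finset.univ fun t => (h t).1 = k).trans_eq (by simp)

lemma sum_pulls {T : ℕ} (h : History K T) : ∑ k, pulls k h = T := by
  simpa [pulls] using (Finset.card_eq_sum_card_fiberwise (s := (Finset.univ : Finset (Fin T)))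
    (t := (Finset.univ : Finset (Fin K))) (f := fun t => (h t).1) (by simp)).symm

lemma pulls_appendRound (k : Fin K) (t : ℕ) (p : ((OfflineData n × History K t) × Fin K) × ℝ) :
    pulls k (appendRound n t p).2 = pulls k p.1.1.2 + if p.1.2 = k then 1 else 0 := by
  rw [pulls_eq_sum, pulls_eq_sum, Fin.sum_univ_castSucc]
  simp only [appendRound, Fin.snoc_castSucc, Fin.snoc_last]

lemma integrable_pulls {T : ℕ} (k : Fin K) (P : Measure (OfflineData n × History K T))
    [IsFiniteMeasure P] : Integrable (fun ω => (pulls k ω.2 : ℝ)) P :=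
  integrable_of_bounds (measurable_pulls_snd k) (fun _ => Nat.cast_nonneg _)
    fun ω => Nat.cast_le.2 (pulls_le k ω.2)

variable (π : Policy n) (ν ν' : Fin K → ProbabilityMeasure ℝ)

lemma expectedPulls_nonneg (k : Fin K) (T : ℕ) : 0 ≤ expectedPulls π ν ν' k T :=
  integral_nonneg fun _ => Nat.cast_nonneg _

lemma expectedPulls_zero (k : Fin K) : expectedPulls π ν ν' k 0 = 0 := by
  simp [expectedPulls, pulls]

lemma sum_expectedPulls (T : ℕ) : ∑ k, expectedPulls π ν ν' k T = T := by
  simp only [expectedPulls]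
  rw [← integral_finsetSum _ fun k _ => integrable_pulls k _]
  have : ∀ ω : OfflineData n × History K T, ∑ k, (pulls k ω.2 : ℝ) = T := fun ω => by
    exact_mod_cast sum_pulls ω.2
  simp [this]

lemma integrable_armIndicator (k : Fin K) {α : Type*} [MeasurableSpace α]
    (P : Measure (α × Fin K)) [IsFiniteMeasure P] :
    Integrable (fun p => if p.2 = k then (1 : ℝ) else 0) P :=
  integrable_of_bounds (a := 0) (b := 1)
    ((measurable_of_countable fun a : Fin K => if a = k then (1 : ℝ) else 0).comp measurable_snd)
    (fun p => by split_ifs <;> norm_num) fun p => by split_ifs <;> norm_num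

lemma integral_fst_compProd {α β : Type*} [MeasurableSpace α] [MeasurableSpace β]
    (P : Measure α) [IsProbabilityMeasure P] (κ : Kernel α β) [IsMarkovKernel κ] {f : α → ℝ}
    (hf : Integrable f P) : ∫ p, f p.1 ∂(P ⊗ₘ κ) = ∫ a, f a ∂P := by
  have h := integral_map (μ := P ⊗ₘ κ) (φ := Prod.fst) measurable_fst.aemeasurable (f := f)
  rw [← Measure.fst, Measure.fst_compProd] at h
  exact (h hf.aestronglyMeasurable).symm

lemma expectedPulls_succ (k : Fin K) (t : ℕ) :
    expectedPulls π ν ν' k (t + 1) = expectedPulls π ν ν' k t +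
      ∫ p, (if p.2 = k then (1 : ℝ) else 0) ∂(law π ν ν' t ⊗ₘ π.choice t) := by
  have hP := integrable_pulls k (law π ν ν' t)
  have h1 : ∫ p, (pulls k p.1.2 : ℝ) ∂(law π ν ν' t ⊗ₘ π.choice t)
      = expectedPulls π ν ν' k t :=
    integral_fst_compProd (law π ν ν' t) (π.choice t) hP
  have hi1 : Integrable (fun p => (pulls k p.1.2 : ℝ)) (law π ν ν' t ⊗ₘ π.choice t) :=
    integrable_of_bounds ((measurable_pulls_snd k).comp measurable_fst)
      (fun _ => Nat.cast_nonneg _) fun p => Nat.cast_le.2 (pulls_le k p.1.2)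
  have hi2 := integrable_armIndicator k (law π ν ν' t ⊗ₘ π.choice t)
  have hi : Integrable (fun p => (pulls k p.1.2 : ℝ) + if p.2 = k then 1 else 0)
      (law π ν ν' t ⊗ₘ π.choice t) := hi1.add hi2
  have h2 := integral_fst_compProd _ ((rewardKernel ν).comap Prod.snd measurable_snd) hi
  have h3 : expectedPulls π ν ν' k (t + 1) = ∫ p, (pulls k (appendRound n t p).2 : ℝ)
      ∂((law π ν ν' t ⊗ₘ π.choice t) ⊗ₘ (rewardKernel ν).comap Prod.snd measurable_snd) :=
    integral_map (measurable_appendRound t).aemeasurable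
      (measurable_pulls_snd k).aestronglyMeasurable
  rw [h3, ← h1, ← integral_add hi1 hi2, ← h2]
  simp only [pulls_appendRound, Nat.cast_add, Nat.cast_ite, Nat.cast_one, Nat.cast_zero]

/-- Divergence decomposition: the strategy is the same on both sides and contributes nothing, while
a round's reward costs `d` exactly when arm `k` is pulled. -/
lemma EntropyBound.law {ρ ρ' : Fin K → ProbabilityMeasure ℝ} {k : Fin K} {c d : ℝ}
    (hoff : EntropyBound (offlineLaw n ν') (offlineLaw n ρ') c)
    (hk : EntropyBound (ν k : Measure ℝ) (ρ k) d) (hne : ∀ j, j ≠ k → ν j = ρ j) (t : ℕ) :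
    EntropyBound (law π ν ν' t) (law π ρ ρ' t) (c + expectedPulls π ν ν' k t * d) := by
  induction t with
  | zero =>
    rw [expectedPulls_zero, zero_mul, add_zero]
    exact hoff.map (Measurable.prodMk measurable_id measurable_const)
  | succ t ih =>
    have h1 := ih.compProd (κ := π.choice t) (η := π.choice t) (integrable_const 0)
      fun a => EntropyBound.refl _
    have h2 := h1.compProd (κ := (rewardKernel ν).comap Prod.snd measurable_snd)
      (η := (rewardKernel ρ).comap Prod.snd measurable_snd)
      ((integrable_armIndicator k _).mul_const d) fun p => by
        change EntropyBound (ν p.2 : Measure ℝ) (ρ p.2) _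
        by_cases h : p.2 = k
        · simpa [h] using hk
        · simpa [h, hne _ h] using EntropyBound.refl (ρ p.2 : Measure ℝ)
    have h3 := h2.map (measurable_appendRound t)
    rw [integral_mul_const, integral_zero, add_zero, add_assoc, ← add_mul,
      ← expectedPulls_succ] at h3
    exact h3

lemma EntropyBound.offlineLaw {ρ' : Fin K → ProbabilityMeasure ℝ} {k : Fin K} {c : ℝ}
    (hn : n k ≠ ⊤) (hk : EntropyBound (ν' k : Measure ℝ) (ρ' k) c)
    (hne : ∀ j, j ≠ k → ν' j = ρ' j) :
    EntropyBound (offlineLaw n ν') (offlineLaw n ρ') ((n k).toNat * c) := by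
  have hcard : Finite {i : ℕ // (i : ℕ∞) < n k} ∧
      Nat.card {i : ℕ // (i : ℕ∞) < n k} = (n k).toNat := by
    obtain ⟨m, hm⟩ := ENat.ne_top_iff_exists.1 hn
    have : {i : ℕ // (i : ℕ∞) < n k} = {i : ℕ // i < m} := by simp [← hm]
    rw [this, ← hm]
    exact ⟨Fin.equivSubtype.finite_iff.1 inferInstance, by
      rw [Nat.card_congr Fin.equivSubtype.symm]; simp⟩
  obtain ⟨hfin, hcard⟩ := hcard
  -- Independence over the arms: only the samples of arm `k` contribute.
  have h := EntropyBound.pi_fin (c := Pi.single k ((n k).toNat * c))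
    (P := fun k => Measure.infinitePi fun _ : {i : ℕ // (i : ℕ∞) < n k} => (ν' k : Measure ℝ))
    (Q := fun k => Measure.infinitePi fun _ : {i : ℕ // (i : ℕ∞) < n k} => (ρ' k : Measure ℝ))
    fun j => by
      by_cases hj : j = k
      · subst hj
        simpa [hcard] using hk.infinitePi_const (ι := {i : ℕ // (i : ℕ∞) < n j})
      · simpa [hj, hne j hj] using EntropyBound.refl _
  rw [Finset.sum_pi_single', if_pos (Finset.mem_univ k)] at h
  exact h

/-- The test function is `1 + T - N_k`: one plus the number of pulls of the other arms. -/
lemma EntropyBound.log_expectedPulls_le {ρ ρ' : Fin K → ProbabilityMeasure ℝ} {T : ℕ} {c : ℝ}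
    (h : EntropyBound (TransferBandit.law π ν ν' T) (TransferBandit.law π ρ ρ' T) c)
    (hT : 0 < T) (k : Fin K) :
    (1 - expectedPulls π ν ν' k T / T) * Real.log (1 + T) ≤
      Real.log (1 + ∑ j ∈ Finset.univ.erase k, expectedPulls π ρ ρ' j T) + c := by
  have hT' : (0 : ℝ) < T := by exact_mod_cast hT
  have hle : ∀ ω : OfflineData n × History K T, (pulls k ω.2 : ℝ) ≤ T := fun ω =>
    Nat.cast_le.2 (pulls_le k ω.2)
  have hm : Measurable fun ω : OfflineData n × History K T => 1 + ((T : ℝ) - pulls k ω.2) :=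
    ((measurable_pulls_snd k).const_sub _).const_add _
  have h1 : ∀ ω : OfflineData n × History K T, 1 ≤ 1 + ((T : ℝ) - pulls k ω.2) := fun ω => by
    linarith [hle ω]
  have hM : ∀ ω : OfflineData n × History K T, 1 + ((T : ℝ) - pulls k ω.2) ≤ 1 + T := fun ω => by
    linarith [Nat.cast_nonneg (α := ℝ) (pulls k ω.2)]
  have key := h _ hm (1 + T) h1 hM
  have hsum : ∫ ω, (1 + ((T : ℝ) - pulls k ω.2)) ∂(TransferBandit.law π ρ ρ' T)
      = 1 + ∑ j ∈ Finset.univ.erase k, expectedPulls π ρ ρ' j T := by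
    simp only [← add_sub_assoc]
    rw [integral_sub (integrable_const _) (integrable_pulls k _)]
    have := Finset.add_sum_erase Finset.univ (fun j => expectedPulls π ρ ρ' j T)
      (Finset.mem_univ k)
    rw [sum_expectedPulls] at this
    simp only [integral_const, probReal_univ, one_smul]
    change 1 + (T : ℝ) - expectedPulls π ρ ρ' k T = _
    linarith
  rw [hsum] at key
  refine le_trans ?_ key
  -- The logarithm lies above its chord from `1` to `1 + T`, taken with weights `N_k / T` and `1 -
  -- N_k / T`.
  have hchord : ∀ ω : OfflineData n × History K T,
      (1 - (pulls k ω.2 : ℝ) / T) * Real.log (1 + T)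
        ≤ Real.log (1 + ((T : ℝ) - pulls k ω.2)) := by
    intro ω
    have hx0 : (0 : ℝ) ≤ pulls k ω.2 := Nat.cast_nonneg _
    have := strictConcaveOn_log_Ioi.concaveOn.2 (Set.mem_Ioi.2 one_pos)
      (Set.mem_Ioi.2 (show (0 : ℝ) < 1 + T by positivity))
      (show 0 ≤ (pulls k ω.2 : ℝ) / (T : ℝ) by positivity)
      (sub_nonneg.2 ((div_le_one hT').2 (hle ω))) (by ring)
    simp only [smul_eq_mul, Real.log_one, mul_zero, zero_add] at this
    refine this.trans_eq (congrArg _ ?_)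
    field_simp
    ring
  have hi : Integrable (fun ω : OfflineData n × History K T => 1 - (pulls k ω.2 : ℝ) / T)
      (TransferBandit.law π ν ν' T) := (integrable_const _).sub ((integrable_pulls k _).div_const (T : ℝ))
  have := integral_mono (hi.mul_const _) (integrable_log_of_bounds hm h1 hM) hchord
  rw [integral_mul_const, integral_sub (integrable_const _) ((integrable_pulls k _).div_const (T : ℝ)),
    integral_div] at this
  simpa [expectedPulls] using this

end Law

end TransferBandit

/-! ### The Gaussian alternative and the limit `q → μ best`. -/

namespace TransferBandit

lemma mean_normal (s : ℝ≥0) (m : ℝ) : mean (normal s m) = m := integral_id_gaussianReal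

lemma entropyBound_normal {s : ℝ≥0} (hs : 0 < s) (m m' : ℝ) :
    EntropyBound (normal s m : Measure ℝ) (normal s m') ((m' - m) ^ 2 / (2 * (s : ℝ) ^ 2)) := by
  simpa [normal] using entropyBound_gaussianReal m m' (pow_ne_zero 2 hs.ne')

/-- The source means moved by the least amount that makes arm `k` compatible with the target
mean `q`. -/
noncomputable def shiftedSource {K : ℕ} (L μ' : Fin K → ℝ) (k : Fin K) (q : ℝ) : Fin K → ℝ :=
  Function.update μ' k (max (μ' k) (q - L k))

lemma abs_update_sub_shiftedSource_le {K : ℕ} {L μ μ' : Fin K → ℝ} (hL : ∀ i, |μ i - μ' i| ≤ L i)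
    {k : Fin K} {q : ℝ} (hq : μ k ≤ q) (i : Fin K) :
    |Function.update μ k q i - shiftedSource L μ' k q i| ≤ L i := by
  by_cases hi : i = k
  · subst hi
    have h := abs_le.1 (hL i)
    simp only [shiftedSource, Function.update_self]
    rw [abs_le]
    rcases le_total (μ' i) (q - L i) with h' | h'
    · rw [max_eq_right h']; constructor <;> linarith
    · rw [max_eq_left h']; constructor <;> linarith
  · simpa [shiftedSource, hi] using hL i

lemma entropyBound_offlineLaw_shiftedSource {K : ℕ} {n : Fin K → ℕ∞} {s : ℝ≥0} (hs : 0 < s)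
    (L μ' : Fin K → ℝ) (k : Fin K) (q : ℝ) (h : offlineCost s (n k) q (μ' k) (L k) ≠ ∞) :
    EntropyBound (offlineLaw n fun i => normal s (μ' i))
      (offlineLaw n fun i => normal s (shiftedSource L μ' k q i))
      (offlineCost s (n k) q (μ' k) (L k)).toReal := by
  have hs' : (0 : ℝ) < s := hs
  -- An unmoved source costs nothing even with infinitely many samples; a moved one has positive
  -- unit cost, so finite total cost forces a finite sample.
  rcases le_or_gt (q - L k) (μ' k) with h' | h'
  · have : shiftedSource L μ' k q = μ' := by simp [shiftedSource, max_eq_left h']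
    rw [this, offlineCost, max_eq_right (by linarith)]
    simpa using EntropyBound.refl _
  · have hmax : max (q - μ' k - L k) 0 = q - L k - μ' k := by
      rw [max_eq_left (by linarith)]; ring
    have hpos : 0 < (q - L k - μ' k) ^ 2 / (2 * (s : ℝ) ^ 2) := by
      have : 0 < q - L k - μ' k := by linarith
      positivity
    rw [offlineCost, hmax] at h ⊢
    have hn : n k ≠ ⊤ := by
      rintro hn
      rw [hn, ENat.toENNReal_top, ENNReal.top_mul (ENNReal.ofReal_pos.2 hpos).ne'] at h
      exact h rfl
    have key := EntropyBound.offlineLaw (fun i => normal s (μ' i)) (k := k) hn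
      (ρ' := fun i => normal s (shiftedSource L μ' k q i))
      (by simpa [shiftedSource, max_eq_right h'.le] using
        entropyBound_normal hs (μ' k) (q - L k))
      fun j hj => by simp [shiftedSource, hj]
    rw [ENNReal.toReal_mul, ENNReal.toReal_ofReal hpos.le]
    obtain ⟨m, hm⟩ := ENat.ne_top_iff_exists.1 hn
    rw [← hm] at key ⊢
    simpa using key

lemma eventually_ofReal_log_le_of_lt {K : ℕ} {σ σ' : ℝ≥0} (hσ : 0 < σ) (hσ' : 0 < σ')
    {L : Fin K → ℝ} {N' : ℕ → Fin K → ℕ∞} {π : (T : ℕ) → Policy (N' T)}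
    (hπ : IsConsistent (normalFamily σ) (normalFamily σ') (fun _ => meanDist) L N' π)
    {μ μ' : Fin K → ℝ} (hL : ∀ i, |μ i - μ' i| ≤ L i) {k : Fin K} (hk : ∃ j, μ k < μ j)
    {q : ℝ} (hq : ∀ i, μ i < q) {δ : ℝ} (hδ : 0 < δ) (hδ1 : δ ≤ 1) :
    ∀ᶠ T : ℕ in atTop, ENNReal.ofReal ((1 - δ) * Real.log T) ≤
      ENNReal.ofReal (expectedPulls (π T) (fun i => normal σ (μ i)) (fun i => normal σ' (μ' i)) k T
        * ((q - μ k) ^ 2 / (2 * (σ : ℝ) ^ 2))) + offlineCost σ' (N' T k) q (μ' k) (L k) := by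
  set ν : Fin K → ProbabilityMeasure ℝ := fun i => normal σ (μ i) with hν
  set ν' : Fin K → ProbabilityMeasure ℝ := fun i => normal σ' (μ' i) with hν'
  set ρ : Fin K → ProbabilityMeasure ℝ := fun i => normal σ (Function.update μ k q i) with hρ
  set ρ' : Fin K → ProbabilityMeasure ℝ := fun i => normal σ' (shiftedSource L μ' k q i) with hρ'
  -- Exponent `1` suffices on the original instance: only `E[N_k] / T → 0` is needed.
  have hEN := hπ ν ν' (fun i => ⟨_, rfl⟩) (fun i => ⟨_, rfl⟩)
    (fun i => by simpa [meanDist, hν, hν', mean_normal] using hL i) k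
    (by simpa [hν, mean_normal] using hk) 1 one_pos
  -- Exponent `δ / 2` here; the other `δ / 2` is lost through `E[N_k] / T`.
  have hES : ∀ j, j ≠ k → (fun T : ℕ => expectedPulls (π T) ρ ρ' j T) =o[atTop]
      fun T : ℕ => (T : ℝ) ^ (δ / 2) := fun j hj =>
    hπ ρ ρ' (fun i => ⟨_, rfl⟩) (fun i => ⟨_, rfl⟩)
      (fun i => by simpa only [meanDist, hρ, hρ', mean_normal] using
        abs_update_sub_shiftedSource_le hL (hq k).le i) j
      ⟨k, by simpa [hρ, mean_normal, hj] using hq j⟩ _ (half_pos hδ)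
  have hone : (fun _ : ℕ => (1 : ℝ)) =o[atTop] fun T : ℕ => (T : ℝ) ^ (δ / 2) :=
    isLittleO_const_left.2 (.inr (tendsto_norm_atTop_atTop.comp
      ((tendsto_rpow_atTop (half_pos hδ)).comp tendsto_natCast_atTop_atTop)))
  have hsum := hone.add (IsLittleO.sum (s := Finset.univ.erase k)
    fun j hj => hES j (Finset.ne_of_mem_erase hj))
  filter_upwards [hEN.def (half_pos hδ), hsum.def one_pos, eventually_ge_atTop 1]
    with T h1 h2 hT
  have hT1 : (1 : ℝ) ≤ T := by exact_mod_cast hT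
  have hT0 : (0 : ℝ) < T := by linarith
  have hlogT : 0 ≤ Real.log T := Real.log_nonneg hT1
  have hE0 := expectedPulls_nonneg (π T) ν ν' k T
  rcases eq_or_ne (offlineCost σ' (N' T k) q (μ' k) (L k)) ∞ with hc | hc
  · simp [hc]
  have hmain := ((entropyBound_offlineLaw_shiftedSource hσ' L μ' k q hc).law (π T) ν ν'
    (ρ := ρ) (k := k) (d := (q - μ k) ^ 2 / (2 * (σ : ℝ) ^ 2))
    (by simpa [hρ, hν] using entropyBound_normal hσ (μ k) q)
    (fun j hj => by simp [hν, hρ, hj]) T).log_expectedPulls_le (π T) ν ν' (by omega) k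
  have hS0 : 0 ≤ ∑ j ∈ Finset.univ.erase k, expectedPulls (π T) ρ ρ' j T :=
    Finset.sum_nonneg fun j _ => expectedPulls_nonneg _ _ _ _ _
  rw [Real.norm_of_nonneg hE0, Real.rpow_one, Real.norm_of_nonneg hT0.le] at h1
  rw [Finset.sum_apply, Real.norm_of_nonneg (by linarith), Real.norm_of_nonneg (by positivity), one_mul] at h2
  have h3 : Real.log (1 + ∑ j ∈ Finset.univ.erase k, expectedPulls (π T) ρ ρ' j T)
      ≤ δ / 2 * Real.log T := by
    rw [← Real.log_rpow hT0]
    exact Real.log_le_log (by linarith) h2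
  have h4 : expectedPulls (π T) ν ν' k T / T ≤ δ / 2 := by rwa [div_le_iff₀ hT0]
  have h5 : (1 - δ / 2) * Real.log T ≤
      (1 - expectedPulls (π T) ν ν' k T / T) * Real.log (1 + T) := by
    apply mul_le_mul (by linarith) (Real.log_le_log hT0 (by linarith)) hlogT (by linarith)
  rw [← ENNReal.ofReal_toReal hc, ← ENNReal.ofReal_add (by positivity) ENNReal.toReal_nonneg]
  exact ENNReal.ofReal_le_ofReal (by linarith)

/-- Below the boundary both costs vanish for `q` near `m`; above it the unit costs have ratio close
to `1`, whatever the sample size. On the boundary the cost at `m` is zero but positive for `q > m`,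
so no factor helps: the logarithmic sample bound supplies the additive error. -/
lemma eventually_offlineCost_le {s : ℝ≥0} (hs : 0 < s) {n : ℕ → ℕ∞} {m m' l : ℝ}
    (hedge : m = m' + l → ∃ C : ℝ≥0, ∀ᶠ T : ℕ in atTop,
      (n T : ℝ≥0∞) ≤ (C : ℝ≥0∞) * ENNReal.ofReal (Real.log T)) {η : ℝ} (hη : 0 < η) :
    ∀ᶠ q in nhds m, ∀ᶠ T : ℕ in atTop, offlineCost s (n T) q m' l ≤
      ENNReal.ofReal (1 + η) * offlineCost s (n T) m m' l + ENNReal.ofReal (η * Real.log T) := by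
  have hs' : (0 : ℝ) < s := hs
  have hcont : Continuous fun q : ℝ => (max (q - m' - l) 0) ^ 2 / (2 * (s : ℝ) ^ 2) := by fun_prop
  rcases lt_trichotomy m (m' + l) with h | h | h
  · filter_upwards [eventually_lt_nhds h] with q hq
    refine .of_forall fun T => ?_
    simp [offlineCost, max_eq_right (show q - m' - l ≤ 0 by linarith)]
  · obtain ⟨C, hC⟩ := hedge h
    have hev : ∀ᶠ q in nhds m, C * ((max (q - m' - l) 0) ^ 2 / (2 * (s : ℝ) ^ 2)) < η :=
      (hcont.const_mul _).continuousAt.eventually_lt_const (by simpa [h] using hη)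
    filter_upwards [hev] with q hq
    filter_upwards [hC, eventually_ge_atTop 1] with T hT hT1
    have hlog : 0 ≤ Real.log T := Real.log_natCast_nonneg T
    refine le_add_left ?_
    calc offlineCost s (n T) q m' l
        ≤ C * ENNReal.ofReal (Real.log T) *
          ENNReal.ofReal ((max (q - m' - l) 0) ^ 2 / (2 * (s : ℝ) ^ 2)) :=
          mul_le_mul_left hT _
      _ = ENNReal.ofReal (C * ((max (q - m' - l) 0) ^ 2 / (2 * (s : ℝ) ^ 2)) * Real.log T) := by
          rw [← ENNReal.ofReal_coe_nnreal, ← ENNReal.ofReal_mul (by positivity),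
            ← ENNReal.ofReal_mul (by positivity)]
          congr 1; ring
      _ ≤ _ := ENNReal.ofReal_le_ofReal (mul_le_mul_of_nonneg_right hq.le hlog)
  · have hpos : 0 < (max (m - m' - l) 0) ^ 2 / (2 * (s : ℝ) ^ 2) := by
      have : 0 < max (m - m' - l) 0 := lt_max_of_lt_left (by linarith)
      positivity
    have hev : ∀ᶠ q in nhds m, (max (q - m' - l) 0) ^ 2 / (2 * (s : ℝ) ^ 2) <
        (1 + η) * ((max (m - m' - l) 0) ^ 2 / (2 * (s : ℝ) ^ 2)) :=
      hcont.continuousAt.eventually_lt_const (by nlinarith)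
    filter_upwards [hev] with q hq
    refine .of_forall fun T => le_add_right ?_
    rw [offlineCost, offlineCost, mul_left_comm, ← ENNReal.ofReal_mul (by positivity)]
    exact mul_le_mul_right (ENNReal.ofReal_le_ofReal hq.le) _

lemma eventually_ofReal_log_le {K : ℕ} {σ σ' : ℝ≥0} (hσ : 0 < σ) (hσ' : 0 < σ')
    {L : Fin K → ℝ} {N' : ℕ → Fin K → ℕ∞} {π : (T : ℕ) → Policy (N' T)}
    (hπ : IsConsistent (normalFamily σ) (normalFamily σ') (fun _ => meanDist) L N' π)
    {μ μ' : Fin K → ℝ} (hL : ∀ i, |μ i - μ' i| ≤ L i)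
    {best : Fin K} (hbest : ∀ i, μ i ≤ μ best) {k : Fin K} (hk : μ k < μ best)
    (hedge : μ best = μ' k + L k → ∃ C : ℝ≥0, ∀ᶠ T : ℕ in atTop,
      (N' T k : ℝ≥0∞) ≤ (C : ℝ≥0∞) * ENNReal.ofReal (Real.log T))
    {δ : ℝ} (hδ : 0 < δ) (hδ1 : δ ≤ 1) :
    ∀ᶠ T : ℕ in atTop, ENNReal.ofReal ((1 - δ) * Real.log T) ≤
      ENNReal.ofReal (expectedPulls (π T) (fun i => normal σ (μ i)) (fun i => normal σ' (μ' i)) k T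
        * ((μ best - μ k) ^ 2 / (2 * (σ : ℝ) ^ 2)))
        + offlineCost σ' (N' T k) (μ best) (μ' k) (L k) := by
  have hσ0 : (0 : ℝ) < σ := hσ
  have hgap : 0 < μ best - μ k := sub_pos.2 hk
  -- One `η` pays for consistency, one for the additive offline error, and one for dividing by `1 +
  -- η`, since `(1 + η)(1 - 3η) ≤ 1 - 2η`.
  obtain ⟨η, rfl⟩ : ∃ η, δ = 3 * η := ⟨δ / 3, by ring⟩
  have hη : 0 < η := by linarith
  have hcont : Continuous fun q : ℝ => (q - μ k) ^ 2 / (2 * (σ : ℝ) ^ 2) := by fun_prop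
  have hev : ∀ᶠ q in nhds (μ best), (q - μ k) ^ 2 / (2 * (σ : ℝ) ^ 2) <
      (1 + η) * ((μ best - μ k) ^ 2 / (2 * (σ : ℝ) ^ 2)) :=
    hcont.continuousAt.eventually_lt_const (by
      have : 0 < (μ best - μ k) ^ 2 / (2 * (σ : ℝ) ^ 2) := by positivity
      nlinarith)
  obtain ⟨q, ⟨hqa, hqc⟩, hq⟩ := (((hev.and
    (eventually_offlineCost_le hσ' (n := fun T => N' T k) hedge hη)).filter_mono
      nhdsWithin_le_nhds).and (self_mem_nhdsWithin (s := Set.Ioi (μ best)))).exists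
  filter_upwards [hqc, eventually_ofReal_log_le_of_lt hσ hσ' hπ hL ⟨best, hk⟩
    (fun i => (hbest i).trans_lt hq) hη (by linarith)] with T hc hm
  have hlog : 0 ≤ Real.log T := Real.log_natCast_nonneg T
  set E := expectedPulls (π T) (fun i => normal σ (μ i)) (fun i => normal σ' (μ' i)) k T
  have hE : 0 ≤ E := expectedPulls_nonneg _ _ _ _ _
  set a := (μ best - μ k) ^ 2 / (2 * (σ : ℝ) ^ 2)
  set c := offlineCost σ' (N' T k) (μ best) (μ' k) (L k)
  have hEa : ENNReal.ofReal (E * ((q - μ k) ^ 2 / (2 * (σ : ℝ) ^ 2))) ≤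
      ENNReal.ofReal (1 + η) * ENNReal.ofReal (E * a) := by
    rw [← ENNReal.ofReal_mul (by positivity)]
    refine ENNReal.ofReal_le_ofReal ?_
    calc _ ≤ E * ((1 + η) * a) := mul_le_mul_of_nonneg_left hqa.le hE
      _ = _ := by ring
  have h1 : ENNReal.ofReal ((1 - 2 * η) * Real.log T) + ENNReal.ofReal (η * Real.log T) ≤
      ENNReal.ofReal (1 + η) * (ENNReal.ofReal (E * a) + c) + ENNReal.ofReal (η * Real.log T) := by
    rw [← ENNReal.ofReal_add (mul_nonneg (by linarith) hlog) (by positivity), ← add_mul,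
      show 1 - 2 * η + η = 1 - η by ring, mul_add, add_assoc]
    exact hm.trans (add_le_add hEa hc)
  have h2 := (ENNReal.add_le_add_iff_right ENNReal.ofReal_ne_top).1 h1
  have h3 : ENNReal.ofReal (1 + η) * ENNReal.ofReal ((1 - 3 * η) * Real.log T) ≤
      ENNReal.ofReal (1 + η) * (ENNReal.ofReal (E * a) + c) := by
    refine le_trans ?_ h2
    rw [← ENNReal.ofReal_mul (by positivity), ← mul_assoc]
    exact ENNReal.ofReal_le_ofReal (mul_le_mul_of_nonneg_right (by nlinarith) hlog)
  exact (ENNReal.mul_le_mul_iff_right (ENNReal.ofReal_pos.2 (by linarith)).ne'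
    ENNReal.ofReal_ne_top).1 h3

end TransferBandit

/-! ### The two asymptotic forms. -/

theorem mainTheorem2 {K : ℕ} (σ σ' : ℝ≥0) (hσ : 0 < σ) (hσ' : 0 < σ')
    (L : Fin K → ℝ) (N' : ℕ → Fin K → ℕ∞)
    (π : (T : ℕ) → TransferBandit.Policy (N' T))
    (hπ : TransferBandit.IsConsistent (TransferBandit.normalFamily σ)
      (TransferBandit.normalFamily σ') (fun _ => TransferBandit.meanDist) L N' π)
    (μ μ' : Fin K → ℝ) (hL : ∀ i, |μ i - μ' i| ≤ L i)
    (best : Fin K) (hbest : ∀ i, μ i ≤ μ best)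
    (k : Fin K) (hk : μ k < μ best)
    (hedge : μ best = μ' k + L k →
      ∃ C : ℝ≥0, ∀ᶠ T : ℕ in atTop,
        (N' T k : ℝ≥0∞) ≤ (C : ℝ≥0∞) * ENNReal.ofReal (Real.log T)) :
    let EN : ℕ → ℝ := fun T => TransferBandit.expectedPulls (π T)
      (fun i => TransferBandit.normal σ (μ i)) (fun i => TransferBandit.normal σ' (μ' i)) k T
    1 ≤ liminf (fun T : ℕ =>
        ENNReal.ofReal (EN T / Real.log T * ((μ best - μ k) ^ 2 / (2 * (σ : ℝ) ^ 2)))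
          + TransferBandit.offlineCost σ' (N' T k) (μ best) (μ' k) (L k)
            / ENNReal.ofReal (Real.log T)) atTop ∧
    ∃ r : ℕ → ℝ, (r =o[atTop] fun T : ℕ => Real.log T) ∧
      ∀ T : ℕ, 2 * (σ : ℝ) ^ 2 / (μ best - μ k) ^ 2 *
          -- truncated subtraction, that is, the positive part of the difference
          (ENNReal.ofReal (Real.log T)
            - TransferBandit.offlineCost σ' (N' T k) (μ best) (μ' k) (L k)).toReal
          + r T ≤ EN T := by
  intro EN
  have hσ0 : (0 : ℝ) < σ := hσ
  have hgap : 0 < μ best - μ k := sub_pos.2 hk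
  have hEN : ∀ T, 0 ≤ EN T := fun T => TransferBandit.expectedPulls_nonneg _ _ _ _ _
  have key : ∀ {δ : ℝ}, 0 < δ → δ ≤ 1 → ∀ᶠ T : ℕ in atTop,
      ENNReal.ofReal ((1 - δ) * Real.log T) ≤
        ENNReal.ofReal (EN T * ((μ best - μ k) ^ 2 / (2 * (σ : ℝ) ^ 2)))
          + TransferBandit.offlineCost σ' (N' T k) (μ best) (μ' k) (L k) :=
    fun hδ hδ1 => TransferBandit.eventually_ofReal_log_le hσ hσ' hπ hL hbest hk hedge hδ hδ1
  have ha : 0 < (μ best - μ k) ^ 2 / (2 * (σ : ℝ) ^ 2) := by positivity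
  have hinv : 2 * (σ : ℝ) ^ 2 / (μ best - μ k) ^ 2 =
      ((μ best - μ k) ^ 2 / (2 * (σ : ℝ) ^ 2))⁻¹ := (inv_div _ _).symm
  rw [hinv]
  set a := (μ best - μ k) ^ 2 / (2 * (σ : ℝ) ^ 2)
  constructor
  · refine le_of_forall_lt fun c hc => ?_
    obtain ⟨c', hcc', hc'⟩ := exists_between hc
    refine hcc'.trans_le (le_liminf_of_le (by isBoundedDefault) ?_)
    have hc'top : c' ≠ ∞ := (hc'.trans ENNReal.one_lt_top).ne
    have hc'1 : c'.toReal < 1 := by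
      simpa using (ENNReal.toReal_lt_toReal hc'top ENNReal.one_ne_top).2 hc'
    -- The choice `δ = 1 - c'` turns `1 - δ` into `c'`; `T ≥ 2` makes the logarithm positive, so
    -- division is harmless.
    filter_upwards [key (δ := 1 - c'.toReal) (by linarith) (by linarith [c'.toReal_nonneg]),
      eventually_ge_atTop 2] with T hT hT2
    have hlog : 0 < Real.log T := Real.log_pos (by exact_mod_cast hT2)
    rw [sub_sub_cancel, ENNReal.ofReal_mul ENNReal.toReal_nonneg,
      ENNReal.ofReal_toReal hc'top] at hT
    rw [div_mul_eq_mul_div, ENNReal.ofReal_div_of_pos hlog, ← ENNReal.add_div]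
    exact (ENNReal.le_div_iff_mul_le (.inl (ENNReal.ofReal_pos.2 hlog).ne')
      (.inl ENNReal.ofReal_ne_top)).2 hT
  -- Taking the negative part of the error makes the inequality hold for every `T`; the asymptotics
  -- are needed only for `r = o(log T)`.
  · refine ⟨fun T => min 0 (EN T - a⁻¹ * (ENNReal.ofReal (Real.log T)
      - TransferBandit.offlineCost σ' (N' T k) (μ best) (μ' k) (L k)).toReal), ?_, fun T => ?_⟩
    · refine IsLittleO.of_bound fun c hc => ?_
      -- The factor `a` cancels the later multiplication by `a⁻¹`; the cap `1` is the range allowed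
      -- in `key`.
      have hη : 0 < min (c * a) 1 := by positivity
      filter_upwards [key hη (min_le_right _ _)] with T hT
      have hlog : 0 ≤ Real.log T := Real.log_natCast_nonneg T
      have hsub : (ENNReal.ofReal (Real.log T)
          - TransferBandit.offlineCost σ' (N' T k) (μ best) (μ' k) (L k)).toReal
            ≤ EN T * a + min (c * a) 1 * Real.log T := by
        refine ENNReal.toReal_le_of_le_ofReal
          (add_nonneg (mul_nonneg (hEN T) ha.le) (by positivity)) (tsub_le_iff_right.2 ?_)
        rw [ENNReal.ofReal_add (mul_nonneg (hEN T) ha.le) (by positivity), add_right_comm]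
        refine le_trans ?_ (add_le_add_left hT _)
        rw [← ENNReal.ofReal_add (mul_nonneg (by linarith [min_le_right (c * a) 1]) hlog)
          (by positivity)]
        exact ENNReal.ofReal_le_ofReal (by linarith)
      have h1 : a⁻¹ * (ENNReal.ofReal (Real.log T)
          - TransferBandit.offlineCost σ' (N' T k) (μ best) (μ' k) (L k)).toReal
            ≤ EN T + c * Real.log T := by
        rw [inv_mul_le_iff₀ ha]
        nlinarith [mul_le_mul_of_nonneg_right (min_le_left (c * a) 1) hlog]
      rw [Real.norm_of_nonneg hlog, Real.norm_of_nonpos (min_le_left _ _), neg_le]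
      exact le_min (by nlinarith) (by linarith)
    · linarith [min_le_right 0 (EN T - a⁻¹ * (ENNReal.ofReal (Real.log T)
        - TransferBandit.offlineCost σ' (N' T k) (μ best) (μ' k) (L k)).toReal)]
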